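/- Let $p$ be an odd prime, let $e$ be a positive integer with $e\equiv 0\pmod 4$, let $q=p^e$, and let $i\in\{0,1\}$ be such that the Legendre symbol satisfies $\left(\frac{e}{p}\right)=(-1)^i$ (in particular $p\nmid e$). Let $\mathrm{Tr}:\mathbb{F}_q\to\mathbb{F}_p$ be the trace, let $C_0$ and $C_1$ be the sets of nonzero squares and of non-squares in $\mathbb{F}_p^*$, and let $\eta$ be the quadratic character of $\mathbb{F}_p$. Put $$D_i=\{x\in\mathbb{F}_q:\mathrm{Tr}(x^{p+1}-x)\in C_i\},\qquad \mathcal{C}_{D_i}=\{(\mathrm{Tr}(ax))_{x\in D_i}:a\in\mathbb{F}_q\}\subseteq\mathbb{F}_p^{D_i}.$$ Then the linear code $\mathcal{C}_{D_i}$ over $\mathbb{F}_p$ has length $$|D_i|=\frac{p-1}{2}p^{e-1}-\frac{1+\eta(-1)p}{2}p^{e/2},$$ dimension $e$, and at most $6$ distinct nonzero Hamming weights. Its weight distribution is as follows, where rows with the same weight (this happens only for $p=3$) are merged by adding their multiplicities, and no codeword has a weight that is not listed. If $p\equiv 1\pmod 4$ (equivalently $\left(\frac{-e}{p}\right)=(-1)^i$):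 $$\begin{array}{ll} \text{Weight} & \text{Multiplicity}\\ 0 & 1\\ \frac{(p-1)^2}{2}p^{e-2}-\frac{p^2-1}{2}p^{\frac e2-1} & p^e-p^{e-2}\\ \frac{(p-1)^2}{2}p^{e-2} & p^{e-4}-1\\ \frac{(p-1)^2}{2}p^{e-2}-\frac{p+1}{2}p^{\frac e2} & \frac{p^2-1}{2}p^{e-4}-(p-1)p^{\frac e2-2}\\ \frac{(p-1)^2}{2}p^{e-2}-\frac{p+3}{2}p^{\frac e2} & \frac{(p-1)(p-3)}{4}p^{e-4}-\frac{(p-1)(p-3)}{4}p^{\frac e2-2}\\ \frac{(p-1)^2}{2}p^{e-2}-\frac{p-1}{2}p^{\frac e2} & \frac{p^2-1}{4}p^{e-4}+\frac{p^2-1}{4}p^{\frac e2-2}\\ \frac{(p-1)^2}{2}p^{e-2}-p^{\frac e2} & (p-1)p^{e-4} \end{array}$$ If $p\equiv 3\pmod 4$ (equivalently $\left(\frac{-e}{p}\right)=(-1)^{1-i}$): $$\begin{array}{ll} \text{Weight} & \text{Multiplicity}\\ 0 & 1\\ \frac{(p-1)^2}{2}p^{e-2}+\frac{(p-1)^2}{2}p^{\frac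 e2-1} & p^e-p^{e-2}\\ \frac{(p-1)^2}{2}p^{e-2} & p^{e-3}-1\\ \frac{(p-1)^2}{2}p^{e-2}+\frac{p-1}{2}p^{\frac e2} & \frac{p^2-1}{2}p^{e-4}\\ \frac{(p-1)^2}{2}p^{e-2}+\frac{p-3}{2}p^{\frac e2} & \frac{(p-1)^2}{4}p^{e-4}-\frac{(p-1)^2}{4}p^{\frac e2-2}\\ \frac{(p-1)^2}{2}p^{e-2}+\frac{p+1}{2}p^{\frac e2} & \frac{(p-1)^2}{4}p^{e-4}+\frac{(p-1)^2}{4}p^{\frac e2-2} \end{array}$$ -/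

import Mathlib

/-- The cyclotomic classes of order two in `𝔽_p^*`: `C_0` is the set of nonzero squares,
`C_1` the set of non-squares. -/
def cyclotomicClass (p : ℕ) (i : Fin 2) : Set (ZMod p) :=
  {y | y ≠ 0 ∧ (IsSquare y ↔ i = 0)}

open Classical in
/-- The defining set `D_i = {x ∈ 𝔽_q : Tr(x^(p+1) - x) ∈ C_i}`. -/
noncomputable def definingSet (p : ℕ) (F : Type*) [Field F] [Fintype F] [Algebra (ZMod p) F]
    (i : Fin 2) : Finset F :=
  {x : F | Algebra.trace (ZMod p) F (x ^ (p + 1) - x) ∈ cyclotomicClass p i}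

/-- The encoding map `a ↦ (Tr(a x))_{x ∈ D}`. -/
noncomputable def codewordMap (p : ℕ) {F : Type*} [Field F] [Algebra (ZMod p) F]
    (D : Finset F) : F →ₗ[ZMod p] (D → ZMod p) :=
  LinearMap.pi fun x => Algebra.trace (ZMod p) F ∘ₗ LinearMap.mulRight (ZMod p) (x : F)

/-- The linear code `C_D = {(Tr(a x))_{x ∈ D} : a ∈ 𝔽_q}`, of length `|D|`. -/
noncomputable def traceCode (p : ℕ) {F : Type*} [Field F] [Algebra (ZMod p) F]
    (D : Finset F) : Submodule (ZMod p) (D → ZMod p) :=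
  LinearMap.range (codewordMap p D)

/-- The number of codewords of Hamming weight `w` in the code `C`. The weight `w` is allowed to
be any rational number (the count is zero unless `w` is a natural number). -/
noncomputable def weightCount {p : ℕ} {ι : Type*} [Fintype ι] (C : Submodule (ZMod p) (ι → ZMod p))
    (w : ℚ) : ℕ :=
  {c : ι → ZMod p | c ∈ C ∧ (hammingNorm c : ℚ) = w}.ncard

/-- `C` has the weight distribution given by the table `T` of pairs (weight, multiplicity): for
every `w`, the number of codewords of weight `w` is the total multiplicity of the rows of weight
`w` (it is zero if there is no such row). -/
def HasWeightTable {p : ℕ} {ι : Type*} [Fintype ι] (C : Submodule (ZMod p) (ι → ZMod p))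
    (T : List (ℚ × ℚ)) : Prop :=
  ∀ w : ℚ, (weightCount C w : ℚ) = (T.map fun r => if r.1 = w then r.2 else 0).sum

/-- The number of nonzero weights of the code `C`, namely `|{1 ≤ w ≤ n : A_w ≠ 0}|`, where `n` is
the length of `C` and `A_w` the number of codewords of weight `w`. -/
noncomputable def numNonzeroWeights {p : ℕ} {ι : Type*} [Fintype ι]
    (C : Submodule (ZMod p) (ι → ZMod p)) : ℕ :=
  ((Finset.Icc 1 (Fintype.card ι)).filter fun w : ℕ => weightCount C (w : ℚ) ≠ 0).card

/-- The table for `p ≡ 1 mod 4`. -/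
def tableOne (p e : ℕ) : List (ℚ × ℚ) :=
  [(0, 1),
   (((p : ℚ) - 1) ^ 2 / 2 * (p : ℚ) ^ (e - 2) - ((p : ℚ) ^ 2 - 1) / 2 * (p : ℚ) ^ (e / 2 - 1),
    (p : ℚ) ^ e - (p : ℚ) ^ (e - 2)),
   (((p : ℚ) - 1) ^ 2 / 2 * (p : ℚ) ^ (e - 2),
    (p : ℚ) ^ (e - 4) - 1),
   (((p : ℚ) - 1) ^ 2 / 2 * (p : ℚ) ^ (e - 2) - ((p : ℚ) + 1) / 2 * (p : ℚ) ^ (e / 2),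
    ((p : ℚ) ^ 2 - 1) / 2 * (p : ℚ) ^ (e - 4) - ((p : ℚ) - 1) * (p : ℚ) ^ (e / 2 - 2)),
   (((p : ℚ) - 1) ^ 2 / 2 * (p : ℚ) ^ (e - 2) - ((p : ℚ) + 3) / 2 * (p : ℚ) ^ (e / 2),
    ((p : ℚ) - 1) * ((p : ℚ) - 3) / 4 * (p : ℚ) ^ (e - 4)
      - ((p : ℚ) - 1) * ((p : ℚ) - 3) / 4 * (p : ℚ) ^ (e / 2 - 2)),
   (((p : ℚ) - 1) ^ 2 / 2 * (p : ℚ) ^ (e - 2) - ((p : ℚ) - 1) / 2 * (p : ℚ) ^ (e / 2),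
    ((p : ℚ) ^ 2 - 1) / 4 * (p : ℚ) ^ (e - 4)
      + ((p : ℚ) ^ 2 - 1) / 4 * (p : ℚ) ^ (e / 2 - 2)),
   (((p : ℚ) - 1) ^ 2 / 2 * (p : ℚ) ^ (e - 2) - (p : ℚ) ^ (e / 2),
    ((p : ℚ) - 1) * (p : ℚ) ^ (e - 4))]

/-- The table for `p ≡ 3 mod 4`. -/
def tableThree (p e : ℕ) : List (ℚ × ℚ) :=
  [(0, 1),
   (((p : ℚ) - 1) ^ 2 / 2 * (p : ℚ) ^ (e - 2) + ((p : ℚ) - 1) ^ 2 / 2 * (p : ℚ) ^ (e / 2 - 1),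
    (p : ℚ) ^ e - (p : ℚ) ^ (e - 2)),
   (((p : ℚ) - 1) ^ 2 / 2 * (p : ℚ) ^ (e - 2),
    (p : ℚ) ^ (e - 3) - 1),
   (((p : ℚ) - 1) ^ 2 / 2 * (p : ℚ) ^ (e - 2) + ((p : ℚ) - 1) / 2 * (p : ℚ) ^ (e / 2),
    ((p : ℚ) ^ 2 - 1) / 2 * (p : ℚ) ^ (e - 4)),
   (((p : ℚ) - 1) ^ 2 / 2 * (p : ℚ) ^ (e - 2) + ((p : ℚ) - 3) / 2 * (p : ℚ) ^ (e / 2),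
    ((p : ℚ) - 1) ^ 2 / 4 * (p : ℚ) ^ (e - 4)
      - ((p : ℚ) - 1) ^ 2 / 4 * (p : ℚ) ^ (e / 2 - 2)),
   (((p : ℚ) - 1) ^ 2 / 2 * (p : ℚ) ^ (e - 2) + ((p : ℚ) + 1) / 2 * (p : ℚ) ^ (e / 2),
    ((p : ℚ) - 1) ^ 2 / 4 * (p : ℚ) ^ (e - 4)
      + ((p : ℚ) - 1) ^ 2 / 4 * (p : ℚ) ^ (e / 2 - 2))]

/-!
`Q x = Tr (x ^ (p + 1))` is a quadratic form on `F` whose polar form satisfies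
`B(1/2, x) = Tr x`, so that `D_i` consists of the `x` at which `Q x - B(h, x)` has the quadratic
character of `Q h`, for `h = 1/2`. Functionals that do not vanish on the radical of `B` all have the
same weight. The others are of the form `B(γ, ·)`, and averaging over the lines in direction `γ`
expresses their weight through the number of `v` at which `Q (h + v γ)` has the character of
`-Q h`, which depends only on `Q γ` and `B(γ, h)`. The joint distribution of these two values is in
turn determined by the excess `S` of the zero level of `Q` over the other levels. Counting pairs
gives `S ^ 2 = |F| |rad B|`, and the sign of `S` follows from a congruence modulo `p + 1`, because
the `(p + 1)`-st roots of unity act freely on the nonzero points of each level of `Q`.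
-/

open Finset

section QuadraticCharacter

variable {k : Type*} [Field k] [Fintype k]

theorem sum_comp_affine {a : k} (ha : a ≠ 0) (b : k) {M : Type*} [AddCommMonoid M] (f : k → M) :
    ∑ v, f (a * v + b) = ∑ v, f v :=
  Fintype.sum_equiv ((Equiv.mulLeft₀ a ha).trans (Equiv.addRight b)) _ _ fun _ => rfl

variable [DecidableEq k]

theorem card_sq_eq (hk : ringChar k ≠ 2) (a : k) :
    (#{x : k | x ^ 2 = a} : ℤ) = quadraticChar k a + 1 := by
  rw [← quadraticChar_card_sqrts hk a]
  congr 2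
  ext x
  simp

theorem sum_comp_sq (hk : ringChar k ≠ 2) (f : k → ℤ) :
    ∑ x, f (x ^ 2) = ∑ y, (quadraticChar k y + 1) * f y := by
  simp_rw [← card_sq_eq hk, card_filter, Nat.cast_sum, sum_mul]
  rw [sum_comm]
  simp

theorem sum_quadraticChar_mul_sub (hk : ringChar k ≠ 2) {c : k} (hc : c ≠ 0) :
    ∑ y : k, quadraticChar k y * quadraticChar k (y - c) = -1 := by
  have hjacobi : jacobiSum (quadraticChar k) (quadraticChar k) = -quadraticChar k (-1) := by
    simpa only [(quadraticChar_isQuadratic k).inv] using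
      jacobiSum_nontrivial_inv (quadraticChar_ne_one hk)
  have hterm (z : k) : quadraticChar k (c * z + 0) * quadraticChar k (c * z + 0 - c)
      = quadraticChar k (-1) * (quadraticChar k z * quadraticChar k (1 - z)) := by
    have h : c * z + 0 - c = c * (-1 * (1 - z)) := by ring
    rw [h, add_zero, map_mul, map_mul _ c, map_mul _ (-1)]
    linear_combination quadraticChar k (-1) * quadraticChar k z * quadraticChar k (1 - z)
      * quadraticChar_sq_one hc
  rw [← sum_comp_affine hc 0]
  simp_rw [hterm, ← mul_sum]
  rw [← jacobiSum, hjacobi]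
  linear_combination -quadraticChar_sq_one (neg_ne_zero.mpr (one_ne_zero (α := k)))

theorem sum_quadraticChar_comp_sq {ι : Type*} [Fintype ι] (u : ι → k) :
    ∑ i, quadraticChar k (u i) ^ 2 = (Fintype.card ι : ℤ) - #{i | u i = 0} := by
  have hterm (i : ι) : quadraticChar k (u i) ^ 2 = 1 - if u i = 0 then 1 else 0 := by
    split_ifs with h
    · simp [h]
    · rw [quadraticChar_sq_one h, sub_zero]
  simp_rw [hterm, sum_sub_distrib, sum_boole]
  simp

theorem sum_quadraticChar_sq :
    ∑ x : k, quadraticChar k x ^ 2 = (Fintype.card k : ℤ) - 1 := by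
  rw [sum_quadraticChar_comp_sq fun x : k => x, filter_eq' univ 0, if_pos (mem_univ _),
    card_singleton, Nat.cast_one]

theorem sum_quadraticChar_sq_sub (hk : ringChar k ≠ 2) (c : k) :
    ∑ x : k, quadraticChar k (x ^ 2 - c) = if c = 0 then (Fintype.card k : ℤ) - 1 else -1 := by
  rw [sum_comp_sq hk fun y => quadraticChar k (y - c)]
  have hshift : ∑ y, quadraticChar k (y - c) = 0 := by
    rw [← quadraticChar_sum_zero hk]
    exact Fintype.sum_equiv (Equiv.subRight c) _ _ fun _ => rfl
  simp_rw [add_mul, one_mul, sum_add_distrib, hshift, add_zero]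
  split_ifs with hc
  · simp_rw [hc, sub_zero, ← sq, sum_quadraticChar_sq]
  · exact sum_quadraticChar_mul_sub hk hc

theorem comp_quadraticChar_eq_linear_combination (G : ℤ → ℚ) (a : k) :
    G (quadraticChar k a) = G 0 * (1 - (quadraticChar k a : ℚ) ^ 2)
      + G 1 * (((quadraticChar k a : ℚ) ^ 2 + quadraticChar k a) / 2)
      + G (-1) * (((quadraticChar k a : ℚ) ^ 2 - quadraticChar k a) / 2) := by
  by_cases h : a = 0
  · simp [h]
  · rcases quadraticChar_dichotomy h with h | h <;> simp [h]

theorem sum_comp_quadraticChar {ι : Type*} [Fintype ι] (u : ι → k) (G : ℤ → ℚ) :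
    ∑ i, G (quadraticChar k (u i))
      = G 0 * (Fintype.card ι - (∑ i, quadraticChar k (u i) ^ 2 : ℤ))
        + G 1 * (((∑ i, quadraticChar k (u i) ^ 2 : ℤ) + (∑ i, quadraticChar k (u i) : ℤ)) / 2)
        + G (-1)
          * (((∑ i, quadraticChar k (u i) ^ 2 : ℤ) - (∑ i, quadraticChar k (u i) : ℤ)) / 2) := by
  simp_rw [comp_quadraticChar_eq_linear_combination G, sum_add_distrib, ← mul_sum, ← sum_div,
    sum_add_distrib, sum_sub_distrib]
  simp

theorem card_quadraticChar_eq {ι : Type*} [Fintype ι] (u : ι → k) {d : k} (hd : d ≠ 0) :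
    (#{i | quadraticChar k (u i) = quadraticChar k d} : ℚ)
      = ((∑ i, quadraticChar k (u i) ^ 2 : ℤ)
          + quadraticChar k d * (∑ i, quadraticChar k (u i) : ℤ)) / 2 := by
  rw [← sum_boole, sum_comp_quadraticChar u fun n => if n = quadraticChar k d then 1 else 0]
  rcases quadraticChar_dichotomy hd with h | h <;> norm_num [h]; ring

theorem sum_ne_zero_comp_quadraticChar_mul (hk : ringChar k ≠ 2) {d : k} (hd : d ≠ 0) (G : ℤ → ℚ) :
    ∑ b with b ≠ 0, G (quadraticChar k (b * d))
      = (Fintype.card k - 1) / 2 * (G 1 + G (-1)) := by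
  have hsum : ∑ b : k, G (quadraticChar k (b * d)) = ∑ b, G (quadraticChar k b) :=
    Fintype.sum_equiv (Equiv.mulRight₀ d hd) _ _ fun _ => rfl
  rw [filter_ne', sum_erase_eq_sub (mem_univ 0), hsum, zero_mul, quadraticChar_zero,
    sum_comp_quadraticChar (fun b => b) G, sum_quadraticChar_sq, quadraticChar_sum_zero hk]
  push_cast
  ring

theorem quadraticChar_quadratic (hk : ringChar k ≠ 2) {a : k} (ha : a ≠ 0) (b c v : k) :
    quadraticChar k (a * v ^ 2 + b * v + c)
      = quadraticChar k a * quadraticChar k ((2 * a * v + b) ^ 2 - (b ^ 2 - 4 * a * c)) := by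
  have h : (2 * a * v + b) ^ 2 - (b ^ 2 - 4 * a * c)
      = 2 ^ 2 * (a * (a * v ^ 2 + b * v + c)) := by ring
  rw [h, map_mul, quadraticChar_sq_one' (Ring.two_ne_zero hk), one_mul, map_mul, ← mul_assoc, ← sq,
    quadraticChar_sq_one ha, one_mul]

theorem sum_quadraticChar_quadratic (hk : ringChar k ≠ 2) {a : k} (ha : a ≠ 0) (b c : k) :
    ∑ v : k, quadraticChar k (a * v ^ 2 + b * v + c)
      = quadraticChar k a * if b ^ 2 - 4 * a * c = 0 then (Fintype.card k : ℤ) - 1 else -1 := by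
  simp_rw [quadraticChar_quadratic hk ha, ← mul_sum]
  rw [sum_comp_affine (mul_ne_zero (Ring.two_ne_zero hk) ha) b
    (fun x => quadraticChar k (x ^ 2 - (b ^ 2 - 4 * a * c))), sum_quadraticChar_sq_sub hk]

theorem card_quadratic_eq_zero (hk : ringChar k ≠ 2) {a : k} (ha : a ≠ 0) (b c : k) :
    (#{v : k | a * v ^ 2 + b * v + c = 0} : ℤ) = quadraticChar k (b ^ 2 - 4 * a * c) + 1 := by
  have h2 : (2 : k) ≠ 0 := Ring.two_ne_zero hk
  have : NeZero (2 : k) := ⟨h2⟩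
  rw [← card_sq_eq hk, card_filter, card_filter,
    ← sum_comp_affine (mul_ne_zero h2 ha) b fun x => if x ^ 2 = b ^ 2 - 4 * a * c then 1 else 0]
  simp only [sq _, quadratic_eq_zero_iff_discrim_eq_sq ha, discrim, eq_comm]

theorem sum_quadraticChar_quadratic_sq (hk : ringChar k ≠ 2) {a : k} (ha : a ≠ 0) (b c : k) :
    ∑ v : k, quadraticChar k (a * v ^ 2 + b * v + c) ^ 2
      = (Fintype.card k : ℤ) - 1 - quadraticChar k (b ^ 2 - 4 * a * c) := by
  rw [sum_quadraticChar_comp_sq, card_quadratic_eq_zero hk ha]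
  ring

theorem card_quadraticChar_eq_class (hk : ringChar k ≠ 2) {d : k} (hd : d ≠ 0) :
    (#{t : k | quadraticChar k t = quadraticChar k d} : ℚ) = (Fintype.card k - 1) / 2 := by
  rw [card_quadraticChar_eq (fun t => t) hd, sum_quadraticChar_sq, quadraticChar_sum_zero hk]
  push_cast
  ring

end QuadraticCharacter

section QuadraticCharCount

variable {k : Type*} [Field k] [Fintype k] [DecidableEq k]

/-- The number of points at which the quadratic polynomial `a v² + b v + c` has the quadratic
character of `-c`. For a quadratic form with `Q γ = a`, polar form `B γ h = b` and `Q h = c`, these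
are the points of the line `h + k γ` at which `Q` has the character of `-Q h`. -/
def quadraticCharCount (a b c : k) : ℕ :=
  #{v : k | quadraticChar k (a * v ^ 2 + b * v + c) = quadraticChar k (-c)}

theorem quadraticChar_neg (c : k) :
    quadraticChar k (-c) = quadraticChar k (-1) * quadraticChar k c := by
  rw [← map_mul, neg_one_mul]

theorem quadraticCharCount_zero_zero {c : k} (hc : c ≠ 0) :
    (quadraticCharCount 0 0 c : ℚ) = Fintype.card k * (1 + quadraticChar k (-1)) / 2 := by
  have hmul : (quadraticChar k c * quadraticChar k (-c) : ℚ) = quadraticChar k (-1) := by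
    rw [← Int.cast_mul, quadraticChar_neg, mul_left_comm, ← sq, quadraticChar_sq_one hc, mul_one]
  rw [quadraticCharCount, card_quadraticChar_eq _ (neg_ne_zero.mpr hc)]
  simp only [zero_mul, zero_add, quadraticChar_sq_one hc, sum_const, card_univ, nsmul_eq_mul]
  push_cast
  linear_combination (Fintype.card k : ℚ) / 2 * hmul

theorem quadraticCharCount_zero (hk : ringChar k ≠ 2) {b c : k} (hb : b ≠ 0) (hc : c ≠ 0) :
    (quadraticCharCount 0 b c : ℚ) = (Fintype.card k - 1) / 2 := by
  rw [← card_quadraticChar_eq_class hk (neg_ne_zero.mpr hc), quadraticCharCount, card_filter,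
    card_filter, ← sum_comp_affine hb c fun t =>
      if quadraticChar k t = quadraticChar k (-c) then 1 else 0]
  simp

theorem quadraticCharCount_of_ne_zero (hk : ringChar k ≠ 2) {a c : k} (ha : a ≠ 0) (hc : c ≠ 0)
    (b : k) :
    (quadraticCharCount a b c : ℚ)
      = (Fintype.card k - 1 - quadraticChar k (b ^ 2 - 4 * a * c)
          + quadraticChar k (-1) * quadraticChar k (a * c)
            * if quadraticChar k (b ^ 2 - 4 * a * c) = 0 then (Fintype.card k : ℚ) - 1 else -1)
        / 2 := by
  rw [quadraticCharCount, card_quadraticChar_eq _ (neg_ne_zero.mpr hc),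
    sum_quadraticChar_quadratic hk ha, sum_quadraticChar_quadratic_sq hk ha, quadraticChar_neg,
    map_mul _ a c]
  simp only [quadraticChar_eq_zero_iff]
  push_cast
  ring

theorem sum_mul_comp_quadraticCharCount (hk : ringChar k ≠ 2) {a c : k} (ha : a ≠ 0) (hc : c ≠ 0)
    (X Y : ℚ) (G : ℚ → ℚ) {s ε : ℚ} (hs : (quadraticChar k (-1) : ℚ) = s)
    (hε : (quadraticChar k (a * c) : ℚ) = ε) :
    ∑ b, (X + Y * quadraticChar k (b ^ 2 - 4 * a * c)) * G (quadraticCharCount a b c)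
      = (1 + ε) * X * G ((Fintype.card k - 1) * (1 + s * ε) / 2)
        + (Fintype.card k - 2 - ε) / 2 * (X + Y) * G ((Fintype.card k - 2 - s * ε) / 2)
        + (Fintype.card k - ε) / 2 * (X - Y) * G ((Fintype.card k - s * ε) / 2) := by
  have h4 : (4 : k) = 2 ^ 2 := by norm_num
  have h2 : (2 : k) ≠ 0 := Ring.two_ne_zero hk
  have hdisc : quadraticChar k (4 * a * c) = quadraticChar k (a * c) := by
    rw [mul_assoc, map_mul, h4, quadraticChar_sq_one' h2, one_mul]
  have hsum := sum_quadraticChar_sq_sub hk (4 * a * c)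
  rw [if_neg (by simp [h4, h2, ha, hc])] at hsum
  have hsq : ∑ b : k, quadraticChar k (b ^ 2 - 4 * a * c) ^ 2
      = (Fintype.card k : ℤ) - 1 - quadraticChar k (a * c) := by
    have h := sum_quadraticChar_quadratic_sq hk one_ne_zero 0 (-(4 * a * c))
    have : (0 : k) ^ 2 - 4 * 1 * -(4 * a * c) = 2 ^ 2 * (4 * a * c) := by ring
    rw [this, map_mul, quadraticChar_sq_one' h2, hdisc, one_mul] at h
    simpa [sub_eq_add_neg] using h
  simp_rw [quadraticCharCount_of_ne_zero hk ha hc]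
  rw [sum_comp_quadraticChar (fun b => b ^ 2 - 4 * a * c) fun n => (X + Y * n) *
    G ((Fintype.card k - 1 - n + quadraticChar k (-1) * quadraticChar k (a * c)
      * if n = 0 then (Fintype.card k : ℚ) - 1 else -1) / 2), hsum, hsq]
  push_cast
  rw [hs, hε]
  norm_num
  ring_nf

theorem sum_mul_comp_quadraticCharCount_zero (hk : ringChar k ≠ 2) {c : k} (hc : c ≠ 0)
    (X Y : ℚ) (G : ℚ → ℚ) :
    ∑ b, (X + Y * quadraticChar k (b ^ 2 - 4 * 0 * c)) * G (quadraticCharCount 0 b c)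
      = X * G (Fintype.card k * (1 + quadraticChar k (-1)) / 2)
        + (Fintype.card k - 1) * (X + Y) * G ((Fintype.card k - 1) / 2) := by
  have hterm : ∀ b ∈ univ.erase (0 : k),
      (X + Y * quadraticChar k (b ^ 2 - 4 * 0 * c)) * G (quadraticCharCount 0 b c)
        = (X + Y) * G ((Fintype.card k - 1) / 2) := by
    intro b hb
    rw [quadraticCharCount_zero hk (ne_of_mem_erase hb) hc, mul_zero, zero_mul, sub_zero,
      quadraticChar_sq_one' (ne_of_mem_erase hb), Int.cast_one, mul_one]
  have hdisc : (0 : k) ^ 2 - 4 * 0 * c = 0 := by ring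
  rw [← add_sum_erase _ _ (mem_univ 0), sum_congr rfl hterm, sum_const,
    card_erase_of_mem (mem_univ _), card_univ, quadraticCharCount_zero_zero hc, nsmul_eq_mul,
    Nat.cast_sub Fintype.card_pos, hdisc, quadraticChar_zero]
  push_cast
  ring

theorem sum_sum_mul_comp_quadraticCharCount (hk : ringChar k ≠ 2) {c : k} (hc : c ≠ 0)
    (X Y : ℚ) (G : ℚ → ℚ) {q s : ℚ} (hq : (Fintype.card k : ℚ) = q)
    (hs : (quadraticChar k (-1) : ℚ) = s) :
    ∑ a, ∑ b, (X + Y * quadraticChar k (b ^ 2 - 4 * a * c)) * G (quadraticCharCount a b c)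
      = X * G (q * (1 + s) / 2) + (q - 1) * (X + Y) * G ((q - 1) / 2)
        + (q - 1) / 2
          * (2 * X * G ((q - 1) * (1 + s) / 2)
            + (q - 3) / 2 * (X + Y) * G ((q - 2 - s) / 2)
            + (q - 1) / 2 * (X - Y) * G ((q - s) / 2)
            + (q - 1) / 2 * (X + Y) * G ((q - 2 + s) / 2)
            + (q + 1) / 2 * (X - Y) * G ((q + s) / 2)) := by
  rw [← add_sum_erase _ _ (mem_univ 0), sum_mul_comp_quadraticCharCount_zero hk hc, ← filter_ne',
    sum_congr rfl fun a ha => sum_mul_comp_quadraticCharCount hk (mem_filter.mp ha).2 hc X Y G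
      hs rfl,
    sum_ne_zero_comp_quadraticChar_mul hk hc fun ε =>
      (1 + ε) * X * G ((Fintype.card k - 1) * (1 + s * ε) / 2)
      + (Fintype.card k - 2 - ε) / 2 * (X + Y) * G ((Fintype.card k - 2 - s * ε) / 2)
      + (Fintype.card k - ε) / 2 * (X - Y) * G ((Fintype.card k - s * ε) / 2), hq, hs]
  push_cast
  ring_nf

end QuadraticCharCount

theorem sum_comp_eq_sum_card_mul {ι κ : Type*} [Fintype ι] [Fintype κ] [DecidableEq κ]
    (f : ι → κ) (g : κ → ℚ) : ∑ i, g (f i) = ∑ y, (#{i | f i = y} : ℚ) * g y := by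
  simp_rw [← sum_boole, sum_mul, ite_mul, one_mul, zero_mul]
  rw [sum_comm]
  simp

section LinearMap

variable {k V W : Type*} [Field k] [AddCommGroup V] [Module k V] [Fintype V]
  [AddCommGroup W] [Module k W] [DecidableEq W]

theorem card_apply_eq_zero (f : V →ₗ[k] W) : #{v | f v = 0} = Nat.card (LinearMap.ker f) := by
  rw [← Fintype.card_subtype, ← Nat.card_eq_fintype_card]
  rfl

theorem sum_comp_linearMap (f : V →ₗ[k] W) (g : W → ℚ) :
    ∑ v, g (f v) = Nat.card (LinearMap.ker f) * ∑ w ∈ univ.image f, g w := by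
  have hfiber : ∀ w ∈ univ.image f, #{v | f v = w} • g w = Nat.card (LinearMap.ker f) * g w := by
    intro w hw
    rw [← card_apply_eq_zero, nsmul_eq_mul, AddMonoidHom.card_fiber_eq_of_mem_range f
      (by simpa using hw) ⟨0, map_zero f⟩]
  rw [sum_comp, sum_congr rfl hfiber, mul_sum]

variable [Fintype k]

theorem card_mul_sum_comp_dual {f : Module.Dual k V} (hf : f ≠ 0) (g : k → ℚ) :
    (Fintype.card k : ℚ) * ∑ v, g (f v) = Fintype.card V * ∑ t, g t := by
  classical
  have himage : univ.image f = univ :=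
    image_univ_of_surjective (LinearMap.surjective hf)
  have hcard : (Fintype.card V : ℚ) = Nat.card (LinearMap.ker f) * Fintype.card k := by
    simpa [himage] using sum_comp_linearMap f fun _ => 1
  rw [sum_comp_linearMap, himage, hcard]
  ring

theorem card_mul_card_dual_eq [DecidableEq k] {f : Module.Dual k V} (hf : f ≠ 0) (s : k) :
    (Fintype.card k : ℚ) * #{v | f v = s} = Fintype.card V := by
  simpa using card_mul_sum_comp_dual hf fun t => if t = s then 1 else 0

end LinearMap

section QuadraticForm

open QuadraticMap

variable {k V : Type*} [Field k] [AddCommGroup V] [Module k V] (Q : QuadraticForm k V)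

theorem quadraticForm_add_smul (u γ : V) (v : k) :
    Q (u + v • γ) = Q u + v * polarBilin Q γ u + v ^ 2 * Q γ := by
  rw [QuadraticMap.map_add Q, Q.map_smul, polarBilin_apply_apply, polar_smul_right, polar_comm,
    smul_eq_mul, smul_eq_mul]
  ring

theorem polarBilin_self (γ : V) : polarBilin Q γ γ = 2 * Q γ := by
  rw [polarBilin_apply_apply, polar_self, two_nsmul, two_mul]

theorem apply_eq_zero_of_polarBilin_eq_zero (h2 : (2 : k) ≠ 0) {r : V} (hr : polarBilin Q r = 0) :
    Q r = 0 := by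
  have h := polarBilin_self Q r
  rw [hr, LinearMap.zero_apply] at h
  exact (mul_eq_zero.mp h.symm).resolve_left h2

theorem apply_add_of_polarBilin_eq_zero (h2 : (2 : k) ≠ 0) {r : V} (hr : polarBilin Q r = 0)
    (x : V) : Q (r + x) = Q x := by
  rw [QuadraticMap.map_add Q, apply_eq_zero_of_polarBilin_eq_zero Q h2 hr, ← polarBilin_apply_apply,
    hr, LinearMap.zero_apply, zero_add, add_zero]

theorem mem_range_polarBilin [FiniteDimensional k V] {f : Module.Dual k V}
    (hf : ∀ r, polarBilin Q r = 0 → f r = 0) : f ∈ LinearMap.range (polarBilin Q) := by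
  have hann : f ∈ (LinearMap.ker (polarBilin Q)).dualAnnihilator :=
    (Submodule.mem_dualAnnihilator f).mpr hf
  rw [← LinearMap.range_dualMap_eq_dualAnnihilator_ker] at hann
  obtain ⟨φ, rfl⟩ := hann
  obtain ⟨γ, rfl⟩ := (Module.evalEquiv k V).surjective φ
  exact ⟨γ, LinearMap.ext fun u => by simp [polar_comm]⟩

variable [Fintype V] [DecidableEq k]

/-- The zero level of `Q` has exactly `S` more points than every other level. All other levels
then have the same size, so that `S` determines the distribution of the values of `Q`. -/
def HasZeroExcess (Q : QuadraticForm k V) (S : ℤ) : Prop :=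
  ∀ t ≠ 0, (#{x | Q x = 0} : ℤ) = #{x | Q x = t} + S

namespace HasZeroExcess

variable {Q} {S : ℤ} (hQ : HasZeroExcess Q S)

include hQ

theorem card_eq (t : k) :
    (#{x | Q x = t} : ℚ) = #{x | Q x = 0} - S + if t = 0 then (S : ℚ) else 0 := by
  split_ifs with ht
  · rw [ht]; ring
  · rw [← Int.cast_natCast #{x | Q x = 0}, hQ t ht]; push_cast; ring

variable [Fintype k]

theorem sum_comp_eq (φ : k → ℚ) :
    ∑ x, φ (Q x) = (#{x | Q x = 0} - S) * ∑ t, φ t + S * φ 0 := by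
  rw [sum_comp_eq_sum_card_mul, sum_congr rfl fun t _ => by rw [hQ.card_eq t]]
  simp_rw [add_mul, sum_add_distrib, ← mul_sum, ite_mul, zero_mul]
  rw [sum_ite_eq' univ 0, if_pos (mem_univ _)]

theorem card_mul_card_zero :
    (Fintype.card k : ℚ) * #{x | Q x = 0} = Fintype.card V + (Fintype.card k - 1) * S := by
  have h := hQ.sum_comp_eq fun _ => 1
  simp only [sum_const, card_univ, nsmul_eq_mul, mul_one] at h
  linear_combination -h

theorem card_mul_sum_comp (φ : k → ℚ) :
    (Fintype.card k : ℚ) * ∑ x, φ (Q x)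
      = (Fintype.card V - S) * ∑ t, φ t + Fintype.card k * S * φ 0 := by
  linear_combination (Fintype.card k : ℚ) * hQ.sum_comp_eq φ
    + (∑ t, φ t) * hQ.card_mul_card_zero

theorem card_mul_card_apply_eq_apply :
    (Fintype.card k : ℚ) * ∑ y, (#{x | Q x = Q y} : ℚ)
      = Fintype.card V ^ 2 + (Fintype.card k - 1) * S ^ 2 := by
  have htotal : ∑ t : k, (#{x | Q x = t} : ℚ) = Fintype.card V := by
    exact_mod_cast (card_eq_sum_card_fiberwise fun x _ => mem_univ (Q x)).symm
  rw [hQ.card_mul_sum_comp fun t => #{x | Q x = t}, htotal]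
  linear_combination (S : ℚ) * hQ.card_mul_card_zero

end HasZeroExcess

variable [Fintype k]

theorem card_mul_card_apply_add_eq {x : V} (hx : polarBilin Q x ≠ 0) :
    (Fintype.card k : ℚ) * #{y | Q (x + y) = Q y} = Fintype.card V := by
  have hiff (y : V) : Q (x + y) = Q y ↔ polarBilin Q x y = -Q x := by
    rw [QuadraticMap.map_add Q, polarBilin_apply_apply]
    constructor <;> intro h <;> linear_combination h
  simp_rw [hiff]
  exact card_mul_card_dual_eq hx _

theorem card_mul_sum_card_apply_add_eq (h2 : (2 : k) ≠ 0) :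
    (Fintype.card k : ℚ) * ∑ x, (#{y | Q (x + y) = Q y} : ℚ)
      = Fintype.card V * (Fintype.card V
        + (Fintype.card k - 1) * Nat.card (LinearMap.ker (polarBilin Q))) := by
  classical
  have hterm (x : V) : (Fintype.card k : ℚ) * #{y | Q (x + y) = Q y} = Fintype.card V
      + if polarBilin Q x = 0 then (Fintype.card k - 1 : ℚ) * Fintype.card V else 0 := by
    split_ifs with hx
    · simp only [apply_add_of_polarBilin_eq_zero Q h2 hx, filter_true, card_univ]
      ring
    · rw [card_mul_card_apply_add_eq Q hx, add_zero]
  simp_rw [mul_sum, hterm, sum_add_distrib, ← sum_filter, sum_const, card_apply_eq_zero, card_univ,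
    nsmul_eq_mul]
  ring

namespace HasZeroExcess

variable {Q} {S : ℤ} (hQ : HasZeroExcess Q S)

include hQ

omit [Fintype k] in
/- Both sides count the pairs `(x, y)` with `Q (x + y) = Q y`: for fixed `x` this is a linear
condition on `y`, and for fixed `y` it is a level set of `Q`. -/
theorem sq_eq [Finite k] (h2 : (2 : k) ≠ 0) :
    S ^ 2 = Fintype.card V * Nat.card (LinearMap.ker (polarBilin Q)) := by
  have := Fintype.ofFinite k
  have hswap : ∑ x, (#{y | Q (x + y) = Q y} : ℚ) = ∑ y, (#{x | Q x = Q y} : ℚ) := by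
    simp_rw [card_filter, Nat.cast_sum]
    rw [sum_comm]
    exact sum_congr rfl fun y _ => Fintype.sum_equiv (Equiv.addRight y) _ _ fun _ => rfl
  have h := card_mul_sum_card_apply_add_eq Q h2
  rw [hswap, hQ.card_mul_card_apply_eq_apply] at h
  have hq : (Fintype.card k - 1 : ℚ) ≠ 0 :=
    sub_ne_zero.mpr (by exact_mod_cast (Fintype.one_lt_card (α := k)).ne')
  have hS : (S ^ 2 : ℚ) = Fintype.card V * Nat.card (LinearMap.ker (polarBilin Q)) :=
    mul_left_cancel₀ hq (by linear_combination h)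
  exact_mod_cast hS

theorem sum_sum_add_mul_sub (γ : V) (s : k) (φ : k → ℚ) :
    ∑ u, ∑ v, φ (Q u + v * (s - polarBilin Q γ u))
      = (Fintype.card V - S) * ∑ t, φ t + S * ∑ v, φ (s * v - Q γ * v ^ 2) := by
  have hshift (v : k) : ∑ u, φ (Q u + v * (s - polarBilin Q γ u))
      = ∑ u, φ (Q u + (s * v - Q γ * v ^ 2)) := by
    refine (Fintype.sum_equiv (Equiv.addRight (v • γ)) _ _ fun u => congrArg φ ?_).symm
    rw [Equiv.coe_addRight, quadraticForm_add_smul, _root_.map_add, _root_.map_smul,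
      polarBilin_self, smul_eq_mul]
    ring
  have htranslate (c : k) : ∑ t, φ (t + c) = ∑ t, φ t :=
    Fintype.sum_equiv (Equiv.addRight c) _ _ fun _ => rfl
  have hlevel (c : k) : (Fintype.card k : ℚ) * ∑ u, φ (Q u + c)
      = (Fintype.card V - S) * ∑ t, φ t + Fintype.card k * S * φ c := by
    rw [hQ.card_mul_sum_comp fun t => φ (t + c), htranslate, zero_add]
  have hq : (Fintype.card k : ℚ) ≠ 0 := Nat.cast_ne_zero.mpr Fintype.card_ne_zero
  refine mul_left_cancel₀ hq ?_
  rw [sum_comm, mul_sum]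
  simp_rw [hshift, hlevel, sum_add_distrib, sum_const, card_univ, nsmul_eq_mul,
    ← mul_sum]
  ring

/- Averaging `φ` over the lines through `u` in direction `γ` isolates the hyperplane
`polarBilin Q γ u = s`: the averaged function is constant off that hyperplane. -/
theorem sq_card_mul_sum_polarBilin_eq {γ : V} (hγ : polarBilin Q γ ≠ 0) (s : k) (φ : k → ℚ) :
    (Fintype.card k : ℚ) ^ 2 * ∑ u with polarBilin Q γ u = s, φ (Q u)
      = (Fintype.card V - Fintype.card k * S) * ∑ t, φ t
        + Fintype.card k * S * ∑ v, φ (s * v - Q γ * v ^ 2) := by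
  have hline (u : V) : ∑ v, φ (Q u + v * (s - polarBilin Q γ u))
      = ∑ t, φ t + if polarBilin Q γ u = s then Fintype.card k * φ (Q u) - ∑ t, φ t else 0 := by
    split_ifs with hu
    · simp [hu]
    · rw [add_zero, ← sum_comp_affine (sub_ne_zero.mpr (Ne.symm hu)) (Q u) φ]
      exact sum_congr rfl fun v _ => by rw [add_comm, mul_comm]
  have h := hQ.sum_sum_add_mul_sub γ s φ
  simp_rw [hline, sum_add_distrib, ← sum_filter, sum_sub_distrib, ← mul_sum, sum_const, card_univ,
    nsmul_eq_mul] at h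
  linear_combination (Fintype.card k : ℚ) * h + (∑ t, φ t) * card_mul_card_dual_eq hγ s

theorem sq_card_mul_card_eq_and_polarBilin_eq (hk : ringChar k ≠ 2) {γ : V} (hγ : Q γ ≠ 0)
    (t s : k) :
    (Fintype.card k : ℚ) ^ 2 * #{u | polarBilin Q γ u = s ∧ Q u = t}
      = Fintype.card V + Fintype.card k * S * quadraticChar k (s ^ 2 - 4 * t * Q γ) := by
  have hpolar : polarBilin Q γ ≠ 0 := fun h =>
    hγ (apply_eq_zero_of_polarBilin_eq_zero Q (Ring.two_ne_zero hk) h)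
  have hroots : (#{v | s * v - Q γ * v ^ 2 = t} : ℚ)
      = quadraticChar k (s ^ 2 - 4 * t * Q γ) + 1 := by
    have hdisc : s ^ 2 - 4 * t * Q γ = s ^ 2 - 4 * -Q γ * -t := by ring
    have hpoly (v : k) : s * v - Q γ * v ^ 2 = t ↔ -Q γ * v ^ 2 + s * v + -t = 0 := by
      constructor <;> intro h <;> linear_combination h
    have h := card_quadratic_eq_zero hk (neg_ne_zero.mpr hγ) s (-t)
    simp_rw [hpoly, hdisc]
    exact_mod_cast h
  have h := hQ.sq_card_mul_sum_polarBilin_eq hpolar s fun x => if x = t then 1 else 0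
  simp only [sum_boole, filter_filter, filter_eq' univ t, if_pos (mem_univ _), card_singleton,
    hroots] at h
  rw [h]
  push_cast
  ring

theorem sq_card_mul_sum_comp_apply_polarBilin (hk : ringChar k ≠ 2) {γ : V} (hγ : Q γ ≠ 0)
    (G : k → k → ℚ) :
    (Fintype.card k : ℚ) ^ 2 * ∑ u, G (Q u) (polarBilin Q γ u)
      = ∑ t, ∑ s, (Fintype.card V
          + Fintype.card k * S * quadraticChar k (s ^ 2 - 4 * t * Q γ)) * G t s := by
  rw [sum_comp_eq_sum_card_mul (fun u => (Q u, polarBilin Q γ u)) fun z => G z.1 z.2,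
    Fintype.sum_prod_type]
  simp_rw [Prod.mk.injEq, and_comm (a := Q _ = _), mul_sum, ← mul_assoc,
    hQ.sq_card_mul_card_eq_and_polarBilin_eq hk hγ]

end HasZeroExcess

end QuadraticForm

section DualWeight

open Module

variable {k V : Type*} [Field k] [DecidableEq k] [AddCommGroup V] [Module k V]

/-- The Hamming weight of the codeword `(f x)_{x ∈ D}`. -/
def dualWeight (D : Finset V) (f : Dual k V) : ℕ :=
  #{x ∈ D | f x ≠ 0}

theorem card_filter_eq_zero_add_dualWeight (D : Finset V) (f : Dual k V) :
    #{x ∈ D | f x = 0} + dualWeight D f = #D :=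
  card_filter_add_card_filter_not _

theorem dualWeight_zero (D : Finset V) : dualWeight D (0 : Dual k V) = 0 := by
  simp [dualWeight]

variable [Fintype k] [Finite V]

theorem card_mul_card_filter_eq_zero {D : Finset V} {f : Dual k V} {r : V} (hr : f r ≠ 0)
    (hD : ∀ (v : k) (x : V), x + v • r ∈ D ↔ x ∈ D) :
    Fintype.card k * #{x ∈ D | f x = 0} = #D := by
  classical
  have := Fintype.ofFinite V
  have hshift (v : k) : #{x ∈ D | f x = 0} = ∑ x ∈ D, if v * f r + f x = 0 then 1 else 0 := by
    simp_rw [card_filter, ← Fintype.sum_ite_mem D]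
    rw [← Equiv.sum_comp (Equiv.addRight (v • r))]
    refine sum_congr rfl fun x _ => ?_
    simp only [Equiv.coe_addRight, hD, map_add, map_smul, smul_eq_mul, add_comm]
  have hroot (x : V) : ∑ v : k, (if v * f r + f x = 0 then 1 else 0) = 1 := by
    simp_rw [mul_comm _ (f r)]
    rw [sum_comp_affine hr (f x) fun t => if t = 0 then 1 else 0]
    simp
  calc Fintype.card k * #{x ∈ D | f x = 0}
      = ∑ v : k, ∑ x ∈ D, if v * f r + f x = 0 then 1 else 0 := by
        simp_rw [← hshift, sum_const, card_univ, smul_eq_mul]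
    _ = #D := by
        rw [sum_comm]
        simp_rw [hroot, sum_const, smul_eq_mul, mul_one]

end DualWeight

section QuadraticClass

open QuadraticMap Module

variable {k V : Type*} [Field k] [Fintype k] [DecidableEq k] [AddCommGroup V] [Module k V]
  [Fintype V]

/-- The set of the points `x` at which `Q x - B(h, x)` has the quadratic character of `Q h`, where
`B` is the polar form of `Q`. It is the translate by `h` of the set of the points `u` at which
`Q u - Q h` has the character of `Q h`. -/
def quadraticClass (Q : QuadraticForm k V) (h : V) : Finset V :=
  {x | quadraticChar k (Q x - polarBilin Q h x) = quadraticChar k (Q h)}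

variable (k) in
/-- The weight of the codeword of `polarBilin Q γ` in terms of the size `N` of the space, the
excess `S` of the zero level of `Q`, and the number `n` of the points on a line in direction `γ`
counted by `quadraticCharCount`. -/
def polarWeight (N S n : ℚ) : ℚ :=
  ((Fintype.card k - 1) ^ 2 / 2 * N
      + Fintype.card k * S * (Fintype.card k * (1 + quadraticChar k (-1)) / 2 - n))
    / Fintype.card k ^ 2

variable (Q : QuadraticForm k V) {h : V}

omit [Fintype k] [DecidableEq k] [Fintype V] in
theorem apply_add_sub_polarBilin (u h : V) : Q (u + h) - polarBilin Q h (u + h) = Q u - Q h := by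
  rw [QuadraticMap.map_add Q, _root_.map_add, polarBilin_self, polarBilin_apply_apply, polar_comm]
  ring

theorem card_filter_quadraticClass (P : V → Prop) [DecidablePred P] :
    (#{x ∈ quadraticClass Q h | P x} : ℚ)
      = ∑ u with P (u + h),
          if quadraticChar k (Q u - Q h) = quadraticChar k (Q h) then 1 else 0 := by
  rw [quadraticClass, filter_filter, card_filter, sum_filter, Nat.cast_sum,
    ← Equiv.sum_comp (Equiv.addRight h)]
  refine sum_congr rfl fun u _ => ?_
  simp only [Equiv.coe_addRight, apply_add_sub_polarBilin, and_comm, ite_and]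
  split_ifs <;> simp

theorem sum_quadraticChar_sub_eq (hk : ringChar k ≠ 2) {c : k} (hc : c ≠ 0) :
    ∑ t : k, (if quadraticChar k (t - c) = quadraticChar k c then 1 else 0 : ℚ)
      = (Fintype.card k - 1) / 2 := by
  rw [← card_quadraticChar_eq_class hk hc, ← sum_boole]
  exact Fintype.sum_equiv (Equiv.subRight c) _ _ fun _ => rfl

theorem quadraticChar_neg_eq_iff (a b : k) :
    quadraticChar k (-a) = quadraticChar k b ↔ quadraticChar k a = quadraticChar k (-b) := by
  have hsq := quadraticChar_sq_one (neg_ne_zero.mpr (one_ne_zero (α := k)))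
  rw [quadraticChar_neg a, quadraticChar_neg b]
  constructor <;> intro hab
  · rw [← hab, ← mul_assoc, ← _root_.sq, hsq, one_mul]
  · rw [hab, ← mul_assoc, ← _root_.sq, hsq, one_mul]

variable {Q} {S : ℤ} (hQ : HasZeroExcess Q S) (hk : ringChar k ≠ 2) (hh : Q h ≠ 0)

include hQ hk hh

theorem card_mul_card_quadraticClass :
    (Fintype.card k : ℚ) * #(quadraticClass Q h)
      = (Fintype.card V - S) * ((Fintype.card k - 1) / 2)
        + Fintype.card k * S * ((1 + quadraticChar k (-1)) / 2) := by
  have hzero : (if quadraticChar k (0 - Q h) = quadraticChar k (Q h) then 1 else 0 : ℚ)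
      = (1 + quadraticChar k (-1)) / 2 := by
    have hne := quadraticChar_eq_zero_iff.not.mpr hh
    simp only [zero_sub, quadraticChar_neg (Q h), mul_eq_right₀ hne]
    rcases quadraticChar_dichotomy (neg_ne_zero.mpr (one_ne_zero (α := k))) with h1 | h1 <;>
      norm_num [h1]
  have hcard := card_filter_quadraticClass Q (h := h) fun _ => True
  rw [filter_true, filter_true] at hcard
  rw [hcard, hQ.card_mul_sum_comp fun t =>
    if quadraticChar k (t - Q h) = quadraticChar k (Q h) then 1 else 0,
    sum_quadraticChar_sub_eq hk hh, hzero]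

theorem sq_card_mul_card_quadraticClass_polarBilin_eq_zero {γ : V} (hγ : polarBilin Q γ ≠ 0) :
    (Fintype.card k : ℚ) ^ 2 * #{x ∈ quadraticClass Q h | polarBilin Q γ x = 0}
      = (Fintype.card V - Fintype.card k * S) * ((Fintype.card k - 1) / 2)
        + Fintype.card k * S * quadraticCharCount (Q γ) (polarBilin Q γ h) (Q h) := by
  have hline (v : k) : -polarBilin Q γ h * v - Q γ * v ^ 2 - Q h
      = -(Q γ * v ^ 2 + polarBilin Q γ h * v + Q h) := by ring
  rw [card_filter_quadraticClass]
  simp_rw [_root_.map_add, ← eq_neg_iff_add_eq_zero]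
  rw [hQ.sq_card_mul_sum_polarBilin_eq hγ (-polarBilin Q γ h) fun t =>
    if quadraticChar k (t - Q h) = quadraticChar k (Q h) then 1 else 0,
    sum_quadraticChar_sub_eq hk hh]
  simp_rw [hline, quadraticChar_neg_eq_iff, sum_boole]
  rfl

theorem dualWeight_quadraticClass_polarBilin {γ : V} (hγ : polarBilin Q γ ≠ 0) :
    (dualWeight (quadraticClass Q h) (polarBilin Q γ) : ℚ)
      = polarWeight k (Fintype.card V) S
        (quadraticCharCount (Q γ) (polarBilin Q γ h) (Q h)) := by
  have hq : (Fintype.card k : ℚ) ≠ 0 := Nat.cast_ne_zero.mpr Fintype.card_ne_zero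
  have hsplit : (#{x ∈ quadraticClass Q h | polarBilin Q γ x = 0} : ℚ)
      + dualWeight (quadraticClass Q h) (polarBilin Q γ) = #(quadraticClass Q h) := by
    exact_mod_cast card_filter_eq_zero_add_dualWeight (quadraticClass Q h) (polarBilin Q γ)
  rw [polarWeight, eq_div_iff (pow_ne_zero 2 hq)]
  linear_combination (Fintype.card k : ℚ) ^ 2 * hsplit
    + (Fintype.card k : ℚ) * card_mul_card_quadraticClass hQ hk hh
    - sq_card_mul_card_quadraticClass_polarBilin_eq_zero hQ hk hh hγ

omit hQ hh in
theorem card_mul_dualWeight_quadraticClass {f : Dual k V}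
    (hf : f ∉ LinearMap.range (polarBilin Q)) :
    (Fintype.card k : ℚ) * dualWeight (quadraticClass Q h) f
      = (Fintype.card k - 1) * #(quadraticClass Q h) := by
  classical
  obtain ⟨r, hr, hfr⟩ : ∃ r, polarBilin Q r = 0 ∧ f r ≠ 0 := by
    contrapose! hf
    exact mem_range_polarBilin Q hf
  have hhr : polarBilin Q h r = 0 := by
    rw [polarBilin_apply_apply, polar_comm, ← polarBilin_apply_apply, hr, LinearMap.zero_apply]
  have hinvariant (v : k) (x : V) : x + v • r ∈ quadraticClass Q h ↔ x ∈ quadraticClass Q h := by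
    simp only [quadraticClass, mem_filter, mem_univ, true_and, quadraticForm_add_smul, hr,
      LinearMap.zero_apply, apply_eq_zero_of_polarBilin_eq_zero Q (Ring.two_ne_zero hk) hr,
      _root_.map_add, _root_.map_smul, hhr, smul_zero, mul_zero, add_zero]
  have hzero : (Fintype.card k : ℚ) * #{x ∈ quadraticClass Q h | f x = 0}
      = #(quadraticClass Q h) := by
    exact_mod_cast card_mul_card_filter_eq_zero hfr hinvariant
  have hsplit : (#{x ∈ quadraticClass Q h | f x = 0} : ℚ) + dualWeight (quadraticClass Q h) f
      = #(quadraticClass Q h) := by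
    exact_mod_cast card_filter_eq_zero_add_dualWeight (quadraticClass Q h) f
  linear_combination (Fintype.card k : ℚ) * hsplit - hzero

theorem sq_card_mul_sum_comp_polarWeight (g : ℚ → ℚ) :
    (Fintype.card k : ℚ) ^ 2 * ∑ γ, g (polarWeight k (Fintype.card V) S
        (quadraticCharCount (Q γ) (polarBilin Q γ h) (Q h)))
      = ∑ a, ∑ b, (Fintype.card V + Fintype.card k * S * quadraticChar k (b ^ 2 - 4 * a * Q h))
          * g (polarWeight k (Fintype.card V) S (quadraticCharCount a b (Q h))) := by
  rw [← hQ.sq_card_mul_sum_comp_apply_polarBilin hk hh]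
  simp only [polarBilin_apply_apply, polar_comm Q h]

theorem card_ker_mul_sum_dualWeight_polarBilin [DecidableEq (Dual k V)] (g : ℚ → ℚ) :
    Nat.card (LinearMap.ker (polarBilin Q))
        * ∑ f ∈ univ.image (polarBilin Q), g (dualWeight (quadraticClass Q h) f)
      = ∑ γ, g (polarWeight k (Fintype.card V) S
          (quadraticCharCount (Q γ) (polarBilin Q γ h) (Q h)))
        + Nat.card (LinearMap.ker (polarBilin Q))
          * (g 0 - g ((Fintype.card k - 1) ^ 2 * Fintype.card V / (2 * Fintype.card k ^ 2))) := by
  set w : V → ℚ := fun γ => g (polarWeight k (Fintype.card V) S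
    (quadraticCharCount (Q γ) (polarBilin Q γ h) (Q h)))
  set c := (Fintype.card k - 1 : ℚ) ^ 2 * Fintype.card V / (2 * Fintype.card k ^ 2)
  have hterm (γ : V) : g (dualWeight (quadraticClass Q h) (polarBilin Q γ))
      = w γ + if polarBilin Q γ = 0 then g 0 - g c else 0 := by
    split_ifs with hγ
    · have hw : w γ = g c := by
        simp only [w, hγ, LinearMap.zero_apply, polarWeight,
          apply_eq_zero_of_polarBilin_eq_zero Q (Ring.two_ne_zero hk) hγ,
          quadraticCharCount_zero_zero hh, c]
        congr 1
        ring
      rw [hw, hγ, dualWeight_zero, Nat.cast_zero, add_sub_cancel]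
    · rw [add_zero, dualWeight_quadraticClass_polarBilin hQ hk hh hγ]
  rw [← sum_comp_linearMap (polarBilin Q) fun f => g (dualWeight (quadraticClass Q h) f)]
  simp_rw [hterm, sum_add_distrib, ← sum_filter, sum_const, card_apply_eq_zero, nsmul_eq_mul]

omit hQ hh in
theorem card_ker_mul_sum_dualWeight_compl [Fintype (Dual k V)] [DecidableEq (Dual k V)]
    (g : ℚ → ℚ) :
    Nat.card (LinearMap.ker (polarBilin Q))
        * ∑ f ∈ (univ.image (polarBilin Q))ᶜ, g (dualWeight (quadraticClass Q h) f)
      = Fintype.card V * (Nat.card (LinearMap.ker (polarBilin Q)) - 1)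
        * g ((Fintype.card k - 1) * #(quadraticClass Q h) / Fintype.card k) := by
  have hq : (Fintype.card k : ℚ) ≠ 0 := Nat.cast_ne_zero.mpr Fintype.card_ne_zero
  have hterm : ∀ f ∈ (univ.image (polarBilin Q))ᶜ, g (dualWeight (quadraticClass Q h) f)
      = g ((Fintype.card k - 1) * #(quadraticClass Q h) / Fintype.card k) := by
    intro f hf
    have hrange : f ∉ LinearMap.range (polarBilin Q) := by simpa using hf
    rw [← card_mul_dualWeight_quadraticClass hk hrange, mul_div_cancel_left₀ _ hq]
  have hdual : Fintype.card (Dual k V) = Fintype.card V := by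
    rw [Module.card_eq_pow_finrank (K := k) (V := V), Module.card_eq_pow_finrank (K := k),
      Subspace.dual_finrank_eq]
  have himage : (Fintype.card V : ℚ)
      = Nat.card (LinearMap.ker (polarBilin Q)) * #(univ.image (polarBilin Q)) := by
    simpa using sum_comp_linearMap (polarBilin Q) fun _ => 1
  rw [sum_congr rfl hterm, sum_const, nsmul_eq_mul, card_compl, Nat.cast_sub (card_le_univ _),
    hdual]
  linear_combination
    g ((Fintype.card k - 1) * #(quadraticClass Q h) / Fintype.card k) * himage

end QuadraticClass

section Distribution

open QuadraticMap Module

/-- The numbers `wt a` have the distribution given by the table `T` of pairs (weight, multiplicity).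
Pairing with test functions `g` merges the rows of equal weight and allows rows of multiplicity
zero. -/
def HasDistribution {W : Type*} [Fintype W] (wt : W → ℕ) (T : List (ℚ × ℚ)) : Prop :=
  ∀ g : ℚ → ℚ, ∑ a, g (wt a) = (T.map fun r => r.2 * g r.1).sum

variable {k V : Type*} [Field k] [Fintype k] [DecidableEq k] [AddCommGroup V] [Module k V]
  [Fintype V] [Fintype (Dual k V)] {Q : QuadraticForm k V} {h : V}

theorem sq_card_mul_card_ker_mul_sum_dualWeight {S : ℤ} (hQ : HasZeroExcess Q S)
    (hk : ringChar k ≠ 2) (hh : Q h ≠ 0) (g : ℚ → ℚ) :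
    Fintype.card k ^ 2 * (Nat.card (LinearMap.ker (polarBilin Q))
        * ∑ f : Dual k V, g (dualWeight (quadraticClass Q h) f))
      = (∑ a, ∑ b, (Fintype.card V + Fintype.card k * S * quadraticChar k (b ^ 2 - 4 * a * Q h))
            * g (polarWeight k (Fintype.card V) S (quadraticCharCount a b (Q h))))
        + Fintype.card k ^ 2 * (Nat.card (LinearMap.ker (polarBilin Q))
          * (g 0 - g ((Fintype.card k - 1) ^ 2 * Fintype.card V / (2 * Fintype.card k ^ 2)))
        + Fintype.card V * (Nat.card (LinearMap.ker (polarBilin Q)) - 1)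
          * g ((Fintype.card k - 1) * #(quadraticClass Q h) / Fintype.card k)) := by
  classical
  rw [← sum_add_sum_compl (univ.image (polarBilin Q)), mul_add,
    card_ker_mul_sum_dualWeight_polarBilin hQ hk hh, card_ker_mul_sum_dualWeight_compl hk,
    ← sq_card_mul_sum_comp_polarWeight hQ hk hh]
  ring

variable {n : ℕ} (hQ : HasZeroExcess Q (-(Fintype.card k : ℤ) ^ (n + 3))) (hk : ringChar k ≠ 2)
  (hh : Q h ≠ 0) (hV : Fintype.card V = Fintype.card k ^ (2 * n + 4))

include hQ hk hV

omit [Fintype (Dual k V)] in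
theorem card_ker_polarBilin_eq_sq :
    Nat.card (LinearMap.ker (polarBilin Q)) = Fintype.card k ^ 2 := by
  have hsq := hQ.sq_eq (Ring.two_ne_zero hk)
  have hq : (Fintype.card k : ℤ) ^ (2 * n + 4) ≠ 0 := by positivity
  have hker : (Nat.card (LinearMap.ker (polarBilin Q)) : ℤ) = Fintype.card k ^ 2 := by
    rw [hV] at hsq
    push_cast at hsq
    exact mul_left_cancel₀ hq (by linear_combination -hsq)
  exact_mod_cast hker

include hh

omit [Fintype (Dual k V)] in
theorem card_quadraticClass_eq {s : ℚ} (hs : (quadraticChar k (-1) : ℚ) = s) :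
    (#(quadraticClass Q h) : ℚ)
      = (Fintype.card k - 1) / 2 * Fintype.card k ^ (2 * n + 3)
        - (1 + s * Fintype.card k) / 2 * Fintype.card k ^ (n + 2) := by
  have hq : (Fintype.card k : ℚ) ≠ 0 := Nat.cast_ne_zero.mpr Fintype.card_ne_zero
  have hcard := card_mul_card_quadraticClass hQ hk hh
  rw [hV, hs] at hcard
  push_cast at hcard
  exact mul_left_cancel₀ hq (by linear_combination hcard)

theorem sum_comp_dualWeight {q s : ℚ} (hq : (Fintype.card k : ℚ) = q)
    (hs : (quadraticChar k (-1) : ℚ) = s) {w : ℚ → ℚ}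
    (hw : ∀ P, w P = (q - 1) ^ 2 / 2 * q ^ (2 * n + 2) - q ^ (n + 2) * (q * (1 + s) / 2 - P))
    (g : ℚ → ℚ) :
    ∑ f : Dual k V, g (dualWeight (quadraticClass Q h) f)
      = g 0
        + (q ^ (2 * n + 4) - q ^ (2 * n + 2)) * g ((q - 1) ^ 2 / 2 * q ^ (2 * n + 2)
          - (q - 1) * (1 + s * q) / 2 * q ^ (n + 1))
        + (q ^ (2 * n) - 1) * g (w (q * (1 + s) / 2))
        + (q - 1) * (q ^ (2 * n) - q ^ n) * g (w ((q - 1) / 2))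
        + (q - 1) / 2
          * (2 * q ^ (2 * n) * g (w ((q - 1) * (1 + s) / 2))
            + (q - 3) / 2 * (q ^ (2 * n) - q ^ n) * g (w ((q - 2 - s) / 2))
            + (q - 1) / 2 * (q ^ (2 * n) + q ^ n) * g (w ((q - s) / 2))
            + (q - 1) / 2 * (q ^ (2 * n) - q ^ n) * g (w ((q - 2 + s) / 2))
            + (q + 1) / 2 * (q ^ (2 * n) + q ^ n) * g (w ((q + s) / 2))) := by
  have hq0 : q ≠ 0 := hq ▸ Nat.cast_ne_zero.mpr Fintype.card_ne_zero
  have hpolar (P : ℚ) : polarWeight k ((Fintype.card k ^ (2 * n + 4) : ℕ) : ℚ)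
      ((-(Fintype.card k) ^ (n + 3) : ℤ) : ℚ) P = w P := by
    rw [hw, polarWeight, hs]
    push_cast
    rw [hq]
    field_simp
    ring
  have hradical : (q - 1) ^ 2 * q ^ (2 * n + 4) / (2 * q ^ 2) = w (q * (1 + s) / 2) := by
    rw [hw]
    field_simp
    ring
  have houter : (q - 1) * ((q - 1) / 2 * q ^ (2 * n + 3) - (1 + s * q) / 2 * q ^ (n + 2)) / q
      = (q - 1) ^ 2 / 2 * q ^ (2 * n + 2) - (q - 1) * (1 + s * q) / 2 * q ^ (n + 1) := by
    field_simp
    ring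
  have hsum := sq_card_mul_card_ker_mul_sum_dualWeight hQ hk hh g
  rw [sum_sum_mul_comp_quadraticCharCount hk hh _ _ (fun n => g (polarWeight k _ _ n)) hq hs,
    card_ker_polarBilin_eq_sq hQ hk hV, card_quadraticClass_eq hQ hk hh hV hs, hV] at hsum
  simp only [hpolar] at hsum
  push_cast at hsum
  rw [hq, hradical, houter] at hsum
  refine mul_left_cancel₀ (pow_ne_zero 4 hq0) ?_
  linear_combination hsum

theorem hasDistribution_tableOne (hs : quadraticChar k (-1) = 1) :
    HasDistribution (fun f : Dual k V => dualWeight (quadraticClass Q h) f)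
      (tableOne (Fintype.card k) (2 * n + 4)) := by
  intro g
  rw [sum_comp_dualWeight hQ hk hh hV rfl (congrArg Int.cast hs) (fun _ => rfl)]
  have hhalf : (2 * n + 4) / 2 = n + 2 := by omega
  simp only [tableOne, hhalf, List.map_cons, List.map_nil, List.sum_cons, List.sum_nil,
    Nat.add_sub_cancel_right, Nat.add_one_sub_one, Nat.reduceSubDiff]
  push_cast
  ring_nf

theorem hasDistribution_tableThree (hs : quadraticChar k (-1) = -1) :
    HasDistribution (fun f : Dual k V => dualWeight (quadraticClass Q h) f)
      (tableThree (Fintype.card k) (2 * n + 4)) := by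
  intro g
  rw [sum_comp_dualWeight hQ hk hh hV rfl (congrArg Int.cast hs) (fun _ => rfl)]
  have hhalf : (2 * n + 4) / 2 = n + 2 := by omega
  simp only [tableThree, hhalf, List.map_cons, List.map_nil, List.sum_cons, List.sum_nil,
    Nat.add_sub_cancel_right, Nat.add_one_sub_one, Nat.reduceSubDiff]
  push_cast
  ring_nf

end Distribution

section CyclicGroup

theorem exists_pow_eq_of_pow_eq_one {G : Type*} [CommGroup G] [IsCyclic G] [Finite G] {a b : ℕ}
    (hab : a * b ∣ Nat.card G) {u : G} (hu : u ^ b = 1) : ∃ c, c ^ a = u := by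
  obtain ⟨g, hg⟩ := IsCyclic.exists_generator (α := G)
  obtain ⟨j, rfl⟩ := Subgroup.mem_zpowers_iff.mp (hg u)
  have hb : (b : ℤ) ≠ 0 := by
    exact_mod_cast right_ne_zero_of_mul (ne_zero_of_dvd_ne_zero Nat.card_pos.ne' hab)
  have hdvd : (a * b : ℤ) ∣ j * b := by
    rw [← zpow_natCast, ← zpow_mul, ← orderOf_dvd_iff_zpow_eq_one,
      orderOf_eq_card_of_forall_mem_zpowers hg] at hu
    exact dvd_trans (by exact_mod_cast hab) hu
  obtain ⟨l, rfl⟩ := Int.dvd_of_mul_dvd_mul_right hb hdvd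
  exact ⟨g ^ l, by rw [← zpow_natCast, ← zpow_mul, mul_comm]⟩

theorem card_pow_eq_one {G : Type*} [CommGroup G] [IsCyclic G] [Fintype G] [DecidableEq G] {d : ℕ}
    (hd : d ∣ Nat.card G) : #{g : G | g ^ d = 1} = d := by
  have hker := IsCyclic.card_powMonoidHom_ker G d
  rw [Nat.gcd_eq_right hd, Nat.card_eq_fintype_card, Fintype.card_subtype] at hker
  simpa only [MonoidHom.mem_ker, powMonoidHom_apply] using hker

theorem card_filter_map_eq {G H : Type*} [Group G] [Fintype G] [Group H] [DecidableEq H]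
    (φ : G →* H) (a : G) : #{g | φ g = φ a} = #{g | φ g = 1} :=
  MonoidHom.card_fiber_eq_of_mem_range φ ⟨a, rfl⟩ ⟨1, map_one φ⟩

theorem card_filter_map_eq_one_dvd {G H : Type*} [Group G] [Fintype G] [Group H] [DecidableEq H]
    (φ : G →* H) (P : H → Prop) [DecidablePred P] :
    #{g | φ g = 1} ∣ #{g | P (φ g)} := by
  rw [card_eq_sum_card_image φ {g | P (φ g)}]
  refine dvd_sum fun b hb => ?_
  obtain ⟨a, ha, rfl⟩ := mem_image.mp hb
  have hP : ∀ g, φ g = φ a → P (φ g) := fun g hg => hg ▸ (mem_filter.mp ha).2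
  rw [filter_filter, filter_congr fun g _ => and_iff_right_of_imp (hP g), card_filter_map_eq]

end CyclicGroup

theorem eq_neg_pow_of_sq_eq_of_dvd {q N : ℕ} (hq : 1 < q) (hN : Odd N) {S : ℤ}
    (hS : S ^ 2 = ((q : ℤ) ^ N) ^ 2) (hdvd : (q : ℤ) + 1 ∣ S - 1) : S = -(q : ℤ) ^ N := by
  refine (sq_eq_sq_iff_eq_or_eq_neg.mp hS).resolve_left fun h => ?_
  rw [h] at hdvd
  have htwo : (q : ℤ) + 1 ∣ 2 := by
    have hpow := hN.add_dvd_pow_add_pow (q : ℤ) 1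
    rw [one_pow] at hpow
    simpa [add_sub_sub_cancel, one_add_one_eq_two] using dvd_sub hpow hdvd
  have := Int.le_of_dvd two_pos htwo
  omega

theorem card_filter_eq_add_card_units {F : Type*} [Field F] [Fintype F] [DecidableEq F]
    (P : F → Prop) [DecidablePred P] :
    #{x | P x} = (if P 0 then 1 else 0) + #{u : Fˣ | P u} := by
  have hunits : #{u : Fˣ | P u} = #{x ∈ univ.erase 0 | P x} := by
    refine card_bij (fun u _ => (u : F)) (by simp) (by simp [Units.ext_iff]) fun x hx => ?_
    simp only [mem_filter, mem_erase] at hx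
    exact ⟨Units.mk0 x hx.1.1, by simpa using hx.2, rfl⟩
  rw [hunits, card_filter, card_filter,
    add_sum_erase _ (fun x => if P x then 1 else 0) (mem_univ 0)]

section HermitianTraceForm

open QuadraticMap

variable (k F : Type*) [Field k] [Fintype k] [Field F] [Algebra k F]

/-- The quadratic form `x ↦ Tr (x ^ (q + 1))` on an extension of the field with `q` elements. -/
noncomputable def hermitianTraceForm : QuadraticForm k F :=
  LinearMap.BilinMap.toQuadraticMap
    ((Algebra.traceForm k F).compl₁₂ (FiniteField.frobeniusAlgHom k F).toLinearMap LinearMap.id)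

variable {k F}

theorem hermitianTraceForm_apply (x : F) :
    hermitianTraceForm k F x = Algebra.trace k F (x ^ (Fintype.card k + 1)) := by
  simp [hermitianTraceForm, Algebra.traceForm_apply, pow_succ]

theorem polarBilin_hermitianTraceForm (x y : F) :
    polarBilin (hermitianTraceForm k F) x y
      = Algebra.trace k F (x ^ Fintype.card k * y)
        + Algebra.trace k F (y ^ Fintype.card k * x) := by
  simp [hermitianTraceForm, Algebra.traceForm_apply, LinearMap.BilinMap.polar_toQuadraticMap]

theorem hermitianTraceForm_algebraMap (c : k) :
    hermitianTraceForm k F (algebraMap k F c) = Module.finrank k F * c ^ 2 := by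
  rw [hermitianTraceForm_apply, ← map_pow, Algebra.trace_algebraMap, nsmul_eq_mul, pow_succ,
    FiniteField.pow_card, pow_two]

theorem hermitianTraceForm_mul {c : F} {t : k} (hc : c ^ (Fintype.card k + 1) = algebraMap k F t)
    (x : F) :
    hermitianTraceForm k F (c * x) = t * hermitianTraceForm k F x := by
  rw [hermitianTraceForm_apply, hermitianTraceForm_apply, mul_pow, hc, ← Algebra.smul_def,
    map_smul, smul_eq_mul]

theorem trace_pow_card [Finite F] (x : F) :
    Algebra.trace k F (x ^ Fintype.card k) = Algebra.trace k F x :=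
  Algebra.trace_eq_of_algEquiv (FiniteField.frobeniusAlgEquivOfAlgebraic k F) x

theorem polarBilin_hermitianTraceForm_eq_zero_iff [Finite F] (x : F) :
    polarBilin (hermitianTraceForm k F) x = 0 ↔ x ^ Fintype.card k ^ 2 + x = 0 := by
  have hpolar (y : F) : polarBilin (hermitianTraceForm k F) x y
      = Algebra.trace k F ((x ^ Fintype.card k ^ 2 + x) * y ^ Fintype.card k) := by
    rw [polarBilin_hermitianTraceForm, ← trace_pow_card (x ^ Fintype.card k * y), ← map_add]
    congr 1
    ring
  constructor
  · intro hx
    refine (traceForm_nondegenerate k F).1 _ fun z => ?_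
    obtain ⟨y, rfl⟩ := (FiniteField.frobeniusAlgEquivOfAlgebraic k F).surjective z
    exact (hpolar y).symm.trans (LinearMap.congr_fun hx y)
  · intro hx
    ext y
    rw [hpolar, hx, zero_mul, map_zero, LinearMap.zero_apply]

theorem polarBilin_hermitianTraceForm_algebraMap [Finite F] (c : k) (x : F) :
    polarBilin (hermitianTraceForm k F) (algebraMap k F c) x = 2 * c * Algebra.trace k F x := by
  rw [polarBilin_hermitianTraceForm, ← map_pow, FiniteField.pow_card, mul_comm (x ^ _),
    ← Algebra.smul_def, ← Algebra.smul_def, map_smul, map_smul, trace_pow_card, ← two_smul k,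
    smul_smul, smul_eq_mul]

variable [Fintype F] {m : ℕ} (hF : Fintype.card F = Fintype.card k ^ (2 * m))

include hF

omit [Field k] [Algebra k F] in
theorem card_add_one_mul_card_sub_one_dvd_card_units :
    (Fintype.card k + 1) * (Fintype.card k - 1) ∣ Nat.card Fˣ := by
  rw [Nat.card_units, Nat.card_eq_fintype_card, hF, pow_mul, ← Nat.sq_sub_sq]
  simpa only [one_pow] using Nat.sub_dvd_pow_sub_pow (Fintype.card k ^ 2) 1 m

theorem card_hermitianTraceForm_eq [DecidableEq k] {t : k} (ht : t ≠ 0) :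
    #{x | hermitianTraceForm k F x = t} = #{x | hermitianTraceForm k F x = 1} := by
  obtain ⟨c, hc⟩ := exists_pow_eq_of_pow_eq_one
    (card_add_one_mul_card_sub_one_dvd_card_units hF)
    (u := Units.map (algebraMap k F).toMonoidHom (Units.mk0 t ht)) (by
      rw [← map_pow, show Units.mk0 t ht ^ (Fintype.card k - 1) = 1 from
        Units.ext (FiniteField.pow_card_sub_one_eq_one t ht), map_one])
  have hc' : (c : F) ^ (Fintype.card k + 1) = algebraMap k F t := by
    simpa using congrArg Units.val hc
  refine (card_equiv (Equiv.mulLeft₀ (c : F) c.ne_zero) fun x => ?_).symm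
  simp [hermitianTraceForm_mul hc', ht]

theorem card_add_one_dvd_card_hermitianTraceForm_units [DecidableEq F] (P : k → Prop)
    [DecidablePred P] :
    Fintype.card k + 1 ∣ #{u : Fˣ | P (hermitianTraceForm k F u)} := by
  classical
  have hdvd := card_filter_map_eq_one_dvd (powMonoidHom (α := Fˣ) (Fintype.card k + 1))
    fun v => P (Algebra.trace k F v)
  simp only [powMonoidHom_apply] at hdvd
  rw [card_pow_eq_one (dvd_of_mul_right_dvd
    (card_add_one_mul_card_sub_one_dvd_card_units hF))] at hdvd
  simpa only [hermitianTraceForm_apply, Units.val_pow_eq_pow_val] using hdvd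

variable (hk : ringChar k ≠ 2) (hm : Even m)

include hk hm

omit [Algebra k F] in
theorem sq_card_sub_one_mul_two_dvd_card_units : (Fintype.card k ^ 2 - 1) * 2 ∣ Nat.card Fˣ := by
  obtain ⟨l, rfl⟩ := hm
  have hodd : Odd (Fintype.card k) :=
    Nat.odd_iff.mpr (FiniteField.odd_card_of_char_ne_two hk)
  have hsq : (Fintype.card k ^ 2) ^ 2 - 1
      = (Fintype.card k ^ 2 - 1) * (Fintype.card k ^ 2 + 1) := by
    rw [mul_comm]
    simpa using Nat.sq_sub_sq (Fintype.card k ^ 2) 1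
  calc (Fintype.card k ^ 2 - 1) * 2 ∣ (Fintype.card k ^ 2) ^ 2 - 1 :=
        hsq ▸ mul_dvd_mul_left _ (hodd.pow.add_odd odd_one).two_dvd
    _ ∣ ((Fintype.card k ^ 2) ^ 2) ^ l - 1 := by
        simpa using Nat.sub_dvd_pow_sub_pow ((Fintype.card k ^ 2) ^ 2) 1 l
    _ = Nat.card Fˣ := by
        rw [Nat.card_units, Nat.card_eq_fintype_card, hF]
        ring_nf

theorem card_ker_polarBilin_hermitianTraceForm :
    Nat.card (LinearMap.ker (polarBilin (hermitianTraceForm k F))) = Fintype.card k ^ 2 := by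
  classical
  have hdvd := sq_card_sub_one_mul_two_dvd_card_units hF hk hm
  have hq : 1 < Fintype.card k ^ 2 := Nat.one_lt_pow two_ne_zero Fintype.one_lt_card
  obtain ⟨r, hr⟩ := exists_pow_eq_of_pow_eq_one hdvd (u := (-1 : Fˣ)) (by norm_num)
  have hunits (u : Fˣ) : (u : F) ^ Fintype.card k ^ 2 + u = 0
      ↔ powMonoidHom (Fintype.card k ^ 2 - 1) u = powMonoidHom (Fintype.card k ^ 2 - 1) r := by
    rw [powMonoidHom_apply, powMonoidHom_apply, hr, Units.ext_iff, ← Nat.sub_add_cancel hq.le,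
      Nat.add_sub_cancel, pow_succ, ← add_one_mul, mul_eq_zero, or_iff_left u.ne_zero,
      ← eq_neg_iff_add_eq_zero]
    simp
  simp only [Nat.card_eq_fintype_card, Fintype.card_subtype, LinearMap.mem_ker,
    polarBilin_hermitianTraceForm_eq_zero_iff]
  rw [card_filter_eq_add_card_units, if_pos (by simp), filter_congr fun u _ => hunits u,
    card_filter_map_eq]
  simp only [powMonoidHom_apply]
  rw [card_pow_eq_one (dvd_of_mul_right_dvd hdvd)]
  omega

theorem hasZeroExcess_hermitianTraceForm [DecidableEq k] :
    HasZeroExcess (hermitianTraceForm k F) (-(Fintype.card k : ℤ) ^ (m + 1)) := by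
  classical
  set N₀ := #{x | hermitianTraceForm k F x = 0} with hN₀
  set N₁ := #{x | hermitianTraceForm k F x = 1} with hN₁
  have hQ : HasZeroExcess (hermitianTraceForm k F) (N₀ - N₁) := fun t ht => by
    rw [card_hermitianTraceForm_eq hF ht, add_sub_cancel]
  have hsq : ((N₀ : ℤ) - N₁) ^ 2 = ((Fintype.card k : ℤ) ^ (m + 1)) ^ 2 := by
    rw [hQ.sq_eq (Ring.two_ne_zero hk), card_ker_polarBilin_hermitianTraceForm hF hk hm, hF]
    push_cast
    ring
  have hdvd : (Fintype.card k : ℤ) + 1 ∣ (N₀ : ℤ) - N₁ - 1 := by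
    have hdvd₀ := card_add_one_dvd_card_hermitianTraceForm_units hF (· = (0 : k))
    have hdvd₁ := card_add_one_dvd_card_hermitianTraceForm_units hF (· = (1 : k))
    rw [hN₀, hN₁, card_filter_eq_add_card_units (fun x : F => hermitianTraceForm k F x = 0),
      card_filter_eq_add_card_units (fun x : F => hermitianTraceForm k F x = 1), map_zero,
      if_pos rfl, if_neg zero_ne_one, zero_add, Nat.cast_add, Nat.cast_one, sub_right_comm,
      add_sub_cancel_left]
    exact dvd_sub (by exact_mod_cast hdvd₀) (by exact_mod_cast hdvd₁)
  rwa [eq_neg_pow_of_sq_eq_of_dvd Fintype.one_lt_card hm.add_one hsq hdvd] at hQ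

end HermitianTraceForm

section WeightTable

namespace HasDistribution

variable {p : ℕ} {ι W : Type*} [Fintype ι] [AddCommGroup W] [Module (ZMod p) W] [Fintype W]
  {φ : W →ₗ[ZMod p] (ι → ZMod p)} {T : List (ℚ × ℚ)}

theorem injective (h : HasDistribution (fun a => hammingNorm (φ a)) ((0, 1) :: T))
    (hT : ∀ r ∈ T, r.1 ≠ 0) : Function.Injective φ := by
  classical
  have hzero := h fun w => if w = 0 then 1 else 0
  have htail : (T.map fun r => r.2 * if r.1 = 0 then (1 : ℚ) else 0).sum = 0 := by
    refine List.sum_eq_zero fun x hx => ?_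
    obtain ⟨r, hr, rfl⟩ := List.mem_map.mp hx
    rw [if_neg (hT r hr), mul_zero]
  rw [List.map_cons, List.sum_cons, htail, sum_boole, if_pos rfl, mul_one, add_zero] at hzero
  have hle : #{a | (hammingNorm (φ a) : ℚ) = 0} ≤ 1 := Nat.cast_le_one.mp hzero.le
  refine (injective_iff_map_eq_zero φ).mpr fun a ha => card_le_one.mp hle a ?_ 0 ?_ <;> simp [ha]

theorem hasWeightTable (h : HasDistribution (fun a => hammingNorm (φ a)) T)
    (hφ : Function.Injective φ) : HasWeightTable (LinearMap.range φ) T := by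
  classical
  intro w
  have hcodewords : {c : ι → ZMod p | c ∈ LinearMap.range φ ∧ (hammingNorm c : ℚ) = w}
      = φ '' ({a | (hammingNorm (φ a) : ℚ) = w} : Finset W) := by
    ext c
    constructor
    · rintro ⟨⟨a, rfl⟩, ha⟩
      exact ⟨a, by simpa using ha, rfl⟩
    · rintro ⟨a, ha, rfl⟩
      exact ⟨⟨a, rfl⟩, by simpa using ha⟩
  rw [weightCount, hcodewords, Set.ncard_image_of_injective _ hφ, Set.ncard_coe_finset,
    ← sum_boole]
  simpa only [mul_ite, mul_one, mul_zero] using h fun x => if x = w then 1 else 0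

end HasDistribution

theorem numNonzeroWeights_le {p : ℕ} {ι : Type*} [Fintype ι] {C : Submodule (ZMod p) (ι → ZMod p)}
    {c : ℚ} {T : List (ℚ × ℚ)} (h : HasWeightTable C ((0, c) :: T)) :
    numNonzeroWeights C ≤ T.length := by
  classical
  calc numNonzeroWeights C ≤ #(T.map Prod.fst).toFinset := by
        refine card_le_card_of_injOn (fun w : ℕ => (w : ℚ)) (fun w hw => ?_)
          Nat.cast_injective.injOn
        obtain ⟨hw, hcount⟩ := mem_filter.mp hw
        have hw0 : (0 : ℚ) ≠ w := by
          exact_mod_cast (Nat.pos_iff_ne_zero.mp (mem_Icc.mp hw).1).symm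
        contrapose! hcount
        have hsum := h w
        rw [List.map_cons, List.sum_cons, if_neg hw0, zero_add, List.sum_eq_zero] at hsum
        · exact_mod_cast hsum
        · intro x hx
          obtain ⟨r, hr, rfl⟩ := List.mem_map.mp hx
          refine if_neg fun hrw => hcount ?_
          exact List.mem_toFinset.mpr (hrw ▸ List.mem_map_of_mem hr)
    _ ≤ T.length := (List.toFinset_card_le _).trans (List.length_map _).le

theorem weight_ne_zero_of_mem_tail_tableOne {p n : ℕ} (hp : 5 ≤ p) :
    ∀ r ∈ (tableOne p (2 * n + 4)).tail, r.1 ≠ 0 := by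
  have hp5 : (5 : ℚ) ≤ p := by exact_mod_cast hp
  have hhalf : (2 * n + 4) / 2 = n + 2 := by omega
  have hlt (c : ℚ) (hc : c < (p - 1) ^ 2 / 2) :
      c * p ^ (n + 2) < (p - 1) ^ 2 / 2 * p ^ (2 * n + 2) :=
    calc c * (p : ℚ) ^ (n + 2) < (p - 1) ^ 2 / 2 * p ^ (n + 2) :=
          mul_lt_mul_of_pos_right hc (by positivity)
      _ ≤ (p - 1) ^ 2 / 2 * p ^ (2 * n + 2) :=
          mul_le_mul_of_nonneg_left (pow_le_pow_right₀ (by linarith) (by omega)) (by positivity)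
  have hle : ((p : ℚ) ^ 2 - 1) / 2 * p ^ (n + 1) ≤ (p + 1) / 2 * p ^ (n + 2) := by
    rw [pow_succ _ (n + 1), mul_comm _ (p : ℚ), ← mul_assoc]
    exact mul_le_mul_of_nonneg_right (by linarith) (by positivity)
  simp only [tableOne, hhalf, List.tail_cons, List.forall_mem_cons, Nat.add_sub_cancel_right,
    Nat.add_one_sub_one, Nat.reduceSubDiff, List.not_mem_nil, false_imp_iff, implies_true, and_true]
  refine ⟨(sub_pos.mpr (hle.trans_lt (hlt _ ?_))).ne', ?_, (sub_pos.mpr (hlt _ ?_)).ne',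
    (sub_pos.mpr (hlt _ ?_)).ne', (sub_pos.mpr (hlt _ ?_)).ne', (sub_pos.mpr ?_).ne'⟩
  · nlinarith
  · simpa only [zero_mul] using (hlt 0 (by nlinarith)).ne'
  · nlinarith
  · nlinarith
  · nlinarith
  · simpa only [one_mul] using hlt 1 (by nlinarith)

theorem weight_ne_zero_of_mem_tail_tableThree {p e : ℕ} (hp : 3 ≤ p) :
    ∀ r ∈ (tableThree p e).tail, r.1 ≠ 0 := by
  have hp3 : (3 : ℚ) ≤ p := by exact_mod_cast hp
  have hsub_one : (0 : ℚ) < (p : ℚ) - 1 := by linarith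
  simp only [tableThree, List.tail_cons, List.forall_mem_cons, List.not_mem_nil, false_imp_iff,
    implies_true, and_true]
  refine ⟨?_, ?_, ?_, ?_, ?_⟩ <;> positivity

end WeightTable

section TraceCode

open Module

variable {p : ℕ} [Fact p.Prime] {F : Type*} [Field F] [Algebra (ZMod p) F]

theorem hammingNorm_codewordMap (D : Finset F) (a : F) :
    hammingNorm (codewordMap p D a) = dualWeight D (Algebra.traceForm (ZMod p) F a) := by
  rw [hammingNorm, dualWeight, card_filter, card_filter, ← sum_coe_sort D]
  rfl

theorem mem_cyclotomicClass_iff {i : Fin 2} (y : ZMod p) :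
    y ∈ cyclotomicClass p i ↔ quadraticChar (ZMod p) y = (-1) ^ (i : ℕ) := by
  by_cases hy : y = 0
  · have hsign : ((-1 : ℤ) ^ (i : ℕ)) ≠ 0 := pow_ne_zero _ (by norm_num)
    simp [cyclotomicClass, hy, hsign.symm]
  · have hsquare := quadraticChar_one_iff_isSquare hy
    have hnonsquare := quadraticChar_neg_one_iff_not_isSquare (a := y)
    fin_cases i <;> simp [cyclotomicClass, hy, hsquare, hnonsquare, -quadraticChar_apply]

variable (hp : p ≠ 2) {i : Fin 2}
  (hi : legendreSym p (finrank (ZMod p) F) = (-1) ^ (i : ℕ))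

include hp hi

theorem quadraticChar_hermitianTraceForm_half :
    quadraticChar (ZMod p) (hermitianTraceForm (ZMod p) F (algebraMap (ZMod p) F 2⁻¹))
      = (-1) ^ (i : ℕ) := by
  have h2 : (2 : ZMod p) ≠ 0 := Ring.two_ne_zero (by rwa [ZMod.ringChar_zmod_n])
  rw [hermitianTraceForm_algebraMap, map_mul, quadraticChar_sq_one' (inv_ne_zero h2), mul_one,
    ← hi, legendreSym, Int.cast_natCast]

theorem hermitianTraceForm_half_ne_zero :
    hermitianTraceForm (ZMod p) F (algebraMap (ZMod p) F 2⁻¹) ≠ 0 := by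
  rw [ne_eq, ← quadraticChar_eq_zero_iff, quadraticChar_hermitianTraceForm_half hp hi]
  exact pow_ne_zero _ (by norm_num)

variable [Fintype F]

omit hp hi in
theorem HasDistribution.codewordMap [Fintype (Dual (ZMod p) F)] {D : Finset F}
    {T : List (ℚ × ℚ)} (h : HasDistribution (fun f : Dual (ZMod p) F => dualWeight D f) T) :
    HasDistribution (fun a => hammingNorm (codewordMap p D a)) T := fun g => by
  rw [← h g]
  refine Fintype.sum_equiv (LinearMap.BilinForm.toDual _
    (traceForm_nondegenerate (ZMod p) F)).toEquiv _ _ fun a => ?_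
  exact congrArg (g ∘ Nat.cast) (hammingNorm_codewordMap D a)

theorem definingSet_eq_quadraticClass :
    definingSet p F i
      = quadraticClass (hermitianTraceForm (ZMod p) F) (algebraMap (ZMod p) F 2⁻¹) := by
  have h2 : (2 : ZMod p) ≠ 0 := Ring.two_ne_zero (by rwa [ZMod.ringChar_zmod_n])
  classical
  ext x
  rw [definingSet, quadraticClass, mem_filter, mem_filter, mem_cyclotomicClass_iff,
    quadraticChar_hermitianTraceForm_half hp hi, polarBilin_hermitianTraceForm_algebraMap,
    hermitianTraceForm_apply, ZMod.card, mul_inv_cancel₀ h2, one_mul, map_sub]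

variable {n : ℕ} (hn : Even n) (hF : Fintype.card F = p ^ (2 * n + 4))

omit hi in
include hn hF in
theorem hasZeroExcess_hermitianTraceForm_zmod :
    HasZeroExcess (hermitianTraceForm (ZMod p) F) (-(Fintype.card (ZMod p) : ℤ) ^ (n + 3)) :=
  hasZeroExcess_hermitianTraceForm (by rw [hF, ZMod.card]; rfl) (by rwa [ZMod.ringChar_zmod_n])
    (hn.add even_two)

include hn hF

theorem card_definingSet :
    (#(definingSet p F i) : ℚ) = (p - 1) / 2 * p ^ (2 * n + 3)
      - (1 + quadraticChar (ZMod p) (-1) * p) / 2 * p ^ (n + 2) := by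
  rw [definingSet_eq_quadraticClass hp hi,
    card_quadraticClass_eq (hasZeroExcess_hermitianTraceForm_zmod hp hn hF)
      (by rwa [ZMod.ringChar_zmod_n]) (hermitianTraceForm_half_ne_zero hp hi)
      (by rw [hF, ZMod.card]) rfl, ZMod.card]

omit hp in
theorem hasDistribution_of_mod_four_eq_one (h1 : p % 4 = 1) :
    HasDistribution (fun a => hammingNorm (codewordMap p (definingSet p F i) a))
      (tableOne p (2 * n + 4)) := by
  have hp : p ≠ 2 := by omega
  have hk : ringChar (ZMod p) ≠ 2 := by rwa [ZMod.ringChar_zmod_n]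
  have := Fintype.ofEquiv F (LinearMap.BilinForm.toDual (Algebra.traceForm (ZMod p) F)
    (traceForm_nondegenerate (ZMod p) F)).toEquiv
  have hdist := hasDistribution_tableOne (hasZeroExcess_hermitianTraceForm_zmod hp hn hF) hk
    (hermitianTraceForm_half_ne_zero hp hi) (by rw [hF, ZMod.card])
    (by rw [quadraticChar_neg_one hk, ZMod.card, ZMod.χ₄_nat_one_mod_four h1])
  rw [ZMod.card, ← definingSet_eq_quadraticClass hp hi] at hdist
  exact hdist.codewordMap

omit hp in
theorem hasDistribution_of_mod_four_eq_three (h3 : p % 4 = 3) :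
    HasDistribution (fun a => hammingNorm (codewordMap p (definingSet p F i) a))
      (tableThree p (2 * n + 4)) := by
  have hp : p ≠ 2 := by omega
  have hk : ringChar (ZMod p) ≠ 2 := by rwa [ZMod.ringChar_zmod_n]
  have := Fintype.ofEquiv F (LinearMap.BilinForm.toDual (Algebra.traceForm (ZMod p) F)
    (traceForm_nondegenerate (ZMod p) F)).toEquiv
  have hdist := hasDistribution_tableThree (hasZeroExcess_hermitianTraceForm_zmod hp hn hF) hk
    (hermitianTraceForm_half_ne_zero hp hi) (by rw [hF, ZMod.card])
    (by rw [quadraticChar_neg_one hk, ZMod.card, ZMod.χ₄_nat_three_mod_four h3])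
  rw [ZMod.card, ← definingSet_eq_quadraticClass hp hi] at hdist
  exact hdist.codewordMap

end TraceCode

theorem theorem8 (p : ℕ) [Fact p.Prime] (hp : p ≠ 2) (e : ℕ) (he : 0 < e) (he4 : e % 4 = 0)
    (F : Type*) [Field F] [Fintype F] [Algebra (ZMod p) F] (hF : Fintype.card F = p ^ e)
    (i : Fin 2) (hi : legendreSym p (e : ℤ) = (-1) ^ (i : ℕ)) :
    ((definingSet p F i).card : ℚ) =
        ((p : ℚ) - 1) / 2 * (p : ℚ) ^ (e - 1)
          - (1 + (quadraticChar (ZMod p) (-1) : ℚ) * (p : ℚ)) / 2 * (p : ℚ) ^ (e / 2) ∧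
      Module.finrank (ZMod p) (traceCode p (definingSet p F i)) = e ∧
      numNonzeroWeights (traceCode p (definingSet p F i)) ≤ 6 ∧
      (p % 4 = 1 → HasWeightTable (traceCode p (definingSet p F i)) (tableOne p e)) ∧
      (p % 4 = 3 → HasWeightTable (traceCode p (definingSet p F i)) (tableThree p e)) := by
  have hprime : p.Prime := Fact.out
  have htwo := hprime.two_le
  obtain ⟨n, hn, rfl⟩ : ∃ n, Even n ∧ e = 2 * n + 4 := ⟨e / 2 - 2, by grind, by omega⟩
  have hrank : Module.finrank (ZMod p) F = 2 * n + 4 := by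
    rw [Module.card_eq_pow_finrank (K := ZMod p), ZMod.card] at hF
    exact Nat.pow_right_injective htwo hF
  rw [← hrank] at hi
  have hcard := card_definingSet hp hi hn hF
  have hfinrank (hinj : Function.Injective (codewordMap p (definingSet p F i))) :
      Module.finrank (ZMod p) (traceCode p (definingSet p F i)) = 2 * n + 4 :=
    (LinearMap.finrank_range_of_inj hinj).trans hrank
  have hhalf : (2 * n + 4) / 2 = n + 2 := by omega
  refine ⟨by rwa [hhalf], ?_⟩
  obtain h1 | h3 : p % 4 = 1 ∨ p % 4 = 3 := Nat.odd_mod_four_iff.mp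
    (hprime.eq_two_or_odd.resolve_left hp)
  · have hdist := hasDistribution_of_mod_four_eq_one hi hn hF h1
    have hinj := hdist.injective (weight_ne_zero_of_mem_tail_tableOne (by omega))
    have htable := hdist.hasWeightTable hinj
    exact ⟨hfinrank hinj, numNonzeroWeights_le htable, fun _ => htable, by omega⟩
  · have hdist := hasDistribution_of_mod_four_eq_three hi hn hF h3
    have hinj := hdist.injective (weight_ne_zero_of_mem_tail_tableThree (by omega))
    have htable := hdist.hasWeightTable hinj
    exact ⟨hfinrank hinj, (numNonzeroWeights_le htable).trans (by simp), by omega,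
      fun _ => htable⟩
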